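/- **Theorem (conditional coverage bound under i.i.d. non-conformity scores).** *Setting.* Let $T\ge 1$, $\alpha,\delta\in(0,1)$, $\gamma>0$. At the times $i=1,\dots,T+1$ we observe responses $Y_i=f(X_i)+\epsilon_i\in\mathbb R^{d}$, where $X_i$ is a regressor (a window of features), $f$ an unknown function and $\epsilon_i$ the noise; $\hat Y_i$ is a point prediction of $Y_i$, $\hat\epsilon_i=Y_i-\hat Y_i$ is the prediction residual, $Z_i$ is the context and $h_i=\mathrm{Enc}(Z_i)\in\mathbb R^{d_h}$ is the guidance, with a fixed encoder $\mathrm{Enc}$. Let $\psi_t(x\mid h)$, $t\in[0,1]$, be a fixed guided flow: $\frac{d}{dt}\psi_t(x\mid h)=u_t(\psi_t(x\mid h)\mid h)$, $\psi_0(x\mid h)=x$, for a guided vector field $u$, every $\psi_t(\cdot\mid h)$ being a bijection of $\mathbb R^d$. Put $e_i=\|\psi_1^{-1}(\epsilon_i\mid h_i)\|$ (true scores) and $\hat e_i=\|\psi_1^{-1}(\hat\epsilon_i\mid h_i)\|$ (estimated scores), and let $F_e(u)=\mathbb P(e_{T+1}\le u)$. *Assumptions.* 1. $e_1,\dots,e_{T+1}$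 are i.i.d. 2. There are $L_\psi,L_{\psi^{-1}}>0$ such that, for all $t\in[0,1]$ and all $h$, $\psi_t(\cdot\mid h)$ is $L_\psi$-Lipschitz and $\psi_t^{-1}(\cdot\mid h)$ is $L_{\psi^{-1}}$-Lipschitz. 3. $F_e$ is Lipschitz with constant $L_{T+1}>0$ and strictly increasing on $[0,\infty)$. 4. With $\Delta_i=\hat\epsilon_i-\epsilon_i$, almost surely $\frac1T\sum_{i=1}^T\|\Delta_i\|^2\le\delta_T^2$ and $\|\Delta_{T+1}\|\le\delta_T$. 5. The flow transports the source distribution to the target: for each $i$, the conditional distribution of $\epsilon_i$ given $Z_i=z$ is the law of $\psi_1(N\mid \mathrm{Enc}(z))$ with $N\sim\mathcal N(0,\gamma I_d)$, for almost every $z$. *Conclusion.* Let $$M_T=\sqrt\gamma\Bigl(\sqrt d+\sqrt{2\log(T/\delta)}\Bigr),\qquad C=\sqrt{M_TL_{\psi^{-1}}\delta_T+L_{\psi^{-1}}^2\delta_T^2},$$ $$B=12\sqrt{\frac{\log(16T)}{T}}+4\Bigl(L_{T+1}+\tfrac12\Bigr)(2C+\delta_T).$$ (a) Let $\widehat C_{T+1}^\alpha=\{y:\|\psi_1^{-1}(y-\hat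 Y_{T+1}\mid h_{T+1})\|\le r_{1-\alpha}\}$, where $r_{1-\alpha}=\sqrt\gamma\,\chi_d^{-1}(1-\alpha)$ is the radius of the centred ball of mass $1-\alpha$ under $\mathcal N(0,\gamma I_d)$. Then, with probability at least $1-\delta$ (over the value of $Z_{T+1}$), $$\bigl|\mathbb P(Y_{T+1}\in\widehat C_{T+1}^\alpha\mid Z_{T+1})-(1-\alpha)\bigr|\le B .$$ (b) If moreover $Z_{T+1}$ is independent of $(e_1,\dots,e_{T+1})$, then for every $\beta\in[0,\alpha]$ the same bound holds, with probability at least $1-\delta$, for the set $\widehat C_{T+1}^{\alpha,\beta}=\{y:\widehat F^{-1}(\beta)\le\|\psi_1^{-1}(y-\hat Y_{T+1}\mid h_{T+1})\|\le\widehat F^{-1}(1-\alpha+\beta)\}$ in place of $\widehat C_{T+1}^\alpha$, where $\widehat F(u)=\frac1T\sum_{i=1}^T\mathbf 1\{\hat e_i\le u\}$ and $\widehat F^{-1}(p)=\inf\{u\ge0:\widehat F(u)\ge p\}$. -/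

import Mathlib

open MeasureTheory ProbabilityTheory

noncomputable section

/-- The space `ℝᵈ` with its Euclidean norm. -/
abbrev Vec (d : ℕ) : Type := EuclideanSpace ℝ (Fin d)

/-- `ψ` is the guided flow of the guided vector field `u` on the time interval `[0,1]`: for every
guidance `h` and every starting point `x`, the curve `t ↦ ψ_t(x | h)` solves
`d/dt ψ_t(x | h) = u_t(ψ_t(x | h) | h)` with `ψ_0(x | h) = x`. The maps `ψ_t(· | h)` are bijections,
and `(ψ t h).symm` is the inverse `ψ_t⁻¹(· | h)`. -/
def IsGuidedFlow {d dh : ℕ} (u : ℝ → Vec d → Vec dh → Vec d)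
    (ψ : ℝ → Vec dh → (Vec d ≃ Vec d)) : Prop :=
  (∀ h x, ψ 0 h x = x) ∧
    ∀ h x, ∀ t ∈ Set.Icc (0 : ℝ) 1,
      HasDerivWithinAt (fun s => ψ s h x) (u t (ψ t h x) h) (Set.Icc (0 : ℝ) 1) t

/-- The flow is Lipschitz in `x` with constant `Lψ` and its inverse with constant `Linv`,
uniformly in the time `t ∈ [0,1]` and the guidance. -/
def IsBiLipschitzFlow {d dh : ℕ} (ψ : ℝ → Vec dh → (Vec d ≃ Vec d)) (Lψ Linv : ℝ) : Prop :=
  ∀ t ∈ Set.Icc (0 : ℝ) 1, ∀ h x x',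
    ‖ψ t h x - ψ t h x'‖ ≤ Lψ * ‖x - x'‖ ∧
      ‖(ψ t h).symm x - (ψ t h).symm x'‖ ≤ Linv * ‖x - x'‖

/-- The source distribution `N(0, γ I_d)`. -/
def sourceMeasure (d : ℕ) (γ : ℝ) : Measure (Vec d) :=
  (stdGaussian (Vec d)).map (fun x => √γ • x)

/-- The chi distribution with `d` degrees of freedom: the law of `‖X‖` for `X ∼ N(0, I_d)`. -/
def chiMeasure (d : ℕ) : Measure ℝ := (stdGaussian (Vec d)).map (fun x => ‖x‖)

/-- The generalized inverse at the level `p` of the cumulative distribution function `F` of a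
nonnegative random variable: the least `u ≥ 0` with `p ≤ F u`. -/
def cdfInv (F : ℝ → ℝ) (p : ℝ) : ℝ := sInf {u : ℝ | 0 ≤ u ∧ p ≤ F u}

/-- The radius `r_p = √γ χ_d⁻¹(p)` of the centred ball of mass `p` under `N(0, γ I_d)`. -/
def radius (d : ℕ) (γ p : ℝ) : ℝ := √γ * cdfInv (cdf (chiMeasure d)) p

/-- The non-conformity score `‖ψ_1⁻¹(r | h)‖` of a residual (or of a noise vector) `r`. -/
def score {d dh : ℕ} (ψ : ℝ → Vec dh → (Vec d ≃ Vec d)) (h : Vec dh) (r : Vec d) : ℝ :=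
  ‖(ψ 1 h).symm r‖

/-- The prediction set `{y : ‖ψ_1⁻¹(y - ŷ | h)‖ ≤ r_{1-α}}`. -/
def predictionSet {d dh : ℕ} (ψ : ℝ → Vec dh → (Vec d ≃ Vec d)) (γ α : ℝ)
    (yhat : Vec d) (h : Vec dh) : Set (Vec d) :=
  {y | score ψ h (y - yhat) ≤ radius d γ (1 - α)}

/-- The empirical cumulative distribution function of `T` scores. -/
def empiricalCDF {T : ℕ} (e : Fin T → ℝ) (u : ℝ) : ℝ :=
  (1 / (T : ℝ)) * ∑ i, if e i ≤ u then 1 else 0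

/-- The prediction set whose score lies between the empirical quantiles of the `T` past scores `e`
at the levels `β` and `1 - α + β`. -/
def quantilePredictionSet {d dh T : ℕ} (ψ : ℝ → Vec dh → (Vec d ≃ Vec d)) (α β : ℝ)
    (e : Fin T → ℝ) (yhat : Vec d) (h : Vec dh) : Set (Vec d) :=
  {y | score ψ h (y - yhat) ∈
    Set.Icc (cdfInv (empiricalCDF e) β) (cdfInv (empiricalCDF e) (1 - α + β))}

/-- `M_T = √γ (√d + √(2 log (T / δ)))`. -/
def normBound (d T : ℕ) (γ δ : ℝ) : ℝ :=
  √γ * (√(d : ℝ) + √(2 * Real.log ((T : ℝ) / δ)))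

/-- `C = √(M_T Linv δ_T + Linv² δ_T²)`. -/
def scoreErrorConst (d T : ℕ) (γ δ Linv δT : ℝ) : ℝ :=
  √(normBound d T γ δ * Linv * δT + Linv ^ 2 * δT ^ 2)

/-- `12 √(log (16 T) / T) + 4 (L + 1/2) (2 C + δ_T)`. -/
def coverageBound (d T : ℕ) (γ δ Linv δT L : ℝ) : ℝ :=
  12 * √(Real.log (16 * (T : ℝ)) / (T : ℝ))
    + 4 * (L + 1 / 2) * (2 * scoreErrorConst d T γ δ Linv δT + δT)

end

/-!
Both bounds hold for almost every value of the test context `Z_{T+1}`.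

Because the flow transports `N(0, γ I_d)` to the conditional law of the noise, the true score
`e_{T+1}` is independent of `Z_{T+1}` and distributed as `‖N‖` for `N ∼ N(0, γ I_d)`
(`map_prodMk_score`). By the Lipschitz bound for the inverse flow, the estimated score differs from
it by at most `s = Linv δ_T`. The conditional probability that the estimated score is at most
`r_{1-α}` therefore lies between `F_e(r_{1-α} - s)` and `F_e(r_{1-α} + s)`, which are within `L s`
of `F_e(r_{1-α}) = 1 - α` (`abs_condProb_le_threshold_sub_le`). This is the first bound.

For the second bound, the coverage event is the difference of `{ê_{T+1} ≤ F̂⁻¹(1-α+β)}` and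
`{ê_{T+1} < F̂⁻¹(β)}`, so one empirical quantile at a time can be treated
(`abs_condProb_lt_quantile_sub_le`). No uniform law for the empirical distribution function is
needed: to locate `F̂⁻¹(p)` between the two points `v` with `F_e(v) = p ± η` it is enough to compare
`F̂` with `F_e` near these points. This is done in two steps. Chebyshev's inequality bounds the
fraction of past scores whose estimate is off by more than `c`, which compares `F̂` with the
empirical distribution function of the true scores (`empiricalCDF_le_add`), and Hoeffding's
inequality compares the latter with `F_e` (`measureReal_le_empiricalCDF_le`,
`measureReal_empiricalCDF_le_le`). Up to an event of small probability, the coverage event is then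
sandwiched between events in terms of the true scores, whose conditional probability given
`Z_{T+1}` is the unconditional one.

With `c = 2 C`, Chebyshev's fraction is at most `L s`, provided that `1 ≤ 4 L M_T`
(`sq_le_mul_sq_scoreErrorConst`). That holds since the scores have second moment `γ d`, so their
law would be too concentrated otherwise (`one_le_four_mul_of_cdf_scoreLaw_le`).
-/

/-! ### Lipschitz distribution functions -/

lemma continuous_of_abs_sub_le_mul {F : ℝ → ℝ} {L : ℝ}
    (hF : ∀ a b, |F a - F b| ≤ L * |a - b|) : Continuous F :=
  (LipschitzWith.of_dist_le' (K := L) fun a b => by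
    simpa only [Real.dist_eq] using hF a b).continuous

lemma measureReal_Iio_eq_cdf (ν : Measure ℝ) [IsProbabilityMeasure ν]
    (hν : Continuous (cdf ν)) (a : ℝ) : ν.real (Set.Iio a) = cdf ν a := by
  have h := (cdf ν).measure_Iio (tendsto_cdf_atBot ν) a
  rw [measure_cdf, hν.continuousAt.continuousWithinAt.leftLim_eq, sub_zero] at h
  rw [measureReal_def, h, ENNReal.toReal_ofReal (cdf_nonneg ν a)]

lemma exists_cdf_eq (ν : Measure ℝ) (hν : Continuous (cdf ν)) (h0 : cdf ν 0 = 0)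
    {p : ℝ} (hp0 : 0 ≤ p) (hp1 : p < 1) : ∃ v, 0 ≤ v ∧ cdf ν v = p := by
  obtain ⟨b, hb0, hb⟩ := ((Filter.eventually_ge_atTop (0 : ℝ)).and
    ((tendsto_cdf_atTop ν).eventually_const_lt hp1)).exists
  obtain ⟨v, hv, hvp⟩ := intermediate_value_Icc hb0 hν.continuousOn ⟨h0.le.trans hp0, hb.le⟩
  exact ⟨v, hv.1, hvp⟩

/-! ### Generalized inverses -/

lemma bddBelow_setOf_nonneg_and (q : ℝ → Prop) : BddBelow {u : ℝ | 0 ≤ u ∧ q u} :=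
  ⟨0, fun _ hu => hu.1⟩

lemma cdfInv_le {F : ℝ → ℝ} {p u : ℝ} (hu : 0 ≤ u) (hp : p ≤ F u) : cdfInv F p ≤ u :=
  csInf_le (bddBelow_setOf_nonneg_and _) ⟨hu, hp⟩

lemma le_cdfInv {F : ℝ → ℝ} (hF : Monotone F) {p v : ℝ} (hne : ∃ u, 0 ≤ u ∧ p ≤ F u)
    (hv : F v < p) : v ≤ cdfInv F p :=
  le_csInf hne fun _ hu => le_of_not_gt fun huv => (hu.2.trans (hF huv.le)).not_gt hv

lemma cdfInv_le_cdfInv {F : ℝ → ℝ} {p q : ℝ} (hne : ∃ u, 0 ≤ u ∧ q ≤ F u) (hpq : p ≤ q) :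
    cdfInv F p ≤ cdfInv F q :=
  csInf_le_csInf (bddBelow_setOf_nonneg_and _) hne fun _ hu => ⟨hu.1, hpq.trans hu.2⟩

/-- A continuous distribution function attains the level `p` at its generalized inverse. -/
lemma apply_cdfInv_eq {F : ℝ → ℝ} (hF : Continuous F) (hmono : Monotone F) {p v : ℝ}
    (hv : 0 ≤ v) (hvp : F v = p) : F (cdfInv F p) = p := by
  apply le_antisymm
  · exact (hmono (cdfInv_le hv hvp.ge)).trans hvp.le
  · have hclosed : IsClosed {u : ℝ | 0 ≤ u ∧ p ≤ F u} :=
      (isClosed_le continuous_const continuous_id).inter (isClosed_le continuous_const hF)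
    exact (hclosed.csInf_mem ⟨v, hv, hvp.ge⟩ (bddBelow_setOf_nonneg_and _)).2

/-- If `G` is `F` in the unit `c > 0`, then `c` times the inverse of `G` at the level `p` is a point
where `F` takes the value `p`. -/
lemma apply_mul_cdfInv_eq {F G : ℝ → ℝ} (hF : Continuous F) (hmono : Monotone F) {c : ℝ}
    (hc : 0 < c) (hG : ∀ v, G v = F (c * v)) {p v : ℝ} (hv : 0 ≤ v) (hvp : F v = p) :
    F (c * cdfInv G p) = p := by
  have hGF : G = fun v => F (c * v) := funext hG
  rw [← hG]
  refine apply_cdfInv_eq (v := v / c) ?_ ?_ (by positivity) ?_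
  · rw [hGF]; fun_prop
  · rw [hGF]; exact fun a b hab => hmono (mul_le_mul_of_nonneg_left hab hc.le)
  · rw [hG, mul_div_cancel₀ _ hc.ne', hvp]

/-! ### Empirical distribution functions -/

lemma empiricalCDF_mono {T : ℕ} (e : Fin T → ℝ) : Monotone (empiricalCDF e) := by
  intro u v huv
  unfold empiricalCDF
  gcongr with i
  split_ifs with h1 h2 <;> first | exact (h2 (h1.trans huv)).elim | norm_num

lemma exists_le_empiricalCDF {T : ℕ} (hT : 1 ≤ T) (e : Fin T → ℝ) {p : ℝ} (hp : p ≤ 1) :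
    ∃ u, 0 ≤ u ∧ p ≤ empiricalCDF e u := by
  refine ⟨∑ i, |e i|, by positivity, hp.trans_eq ?_⟩
  have h : ∀ i, e i ≤ ∑ i, |e i| := fun i => (le_abs_self _).trans
    (Finset.single_le_sum (f := fun i => |e i|) (fun _ _ => abs_nonneg _) (Finset.mem_univ i))
  have hT' : (T : ℝ) ≠ 0 := by positivity
  simp [empiricalCDF, h, hT']

lemma measurable_empiricalCDF {T : ℕ} (u : ℝ) :
    Measurable fun e : Fin T → ℝ => empiricalCDF e u := by
  unfold empiricalCDF
  refine Measurable.const_mul (Finset.measurable_sum _ fun i _ => ?_) _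
  exact Measurable.ite (measurableSet_le (measurable_pi_apply i) measurable_const)
    measurable_const measurable_const

lemma measurable_cdfInv_empiricalCDF {T : ℕ} (hT : 1 ≤ T) {p : ℝ} (hp : p ≤ 1) :
    Measurable fun e : Fin T → ℝ => cdfInv (empiricalCDF e) p := by
  refine measurable_of_Iio fun v => ?_
  -- by monotonicity, the infimum may be tested on rational points
  have h : (fun e : Fin T → ℝ => cdfInv (empiricalCDF e) p) ⁻¹' Set.Iio v =
      ⋃ r : ℚ, {e | (0 ≤ (r : ℝ) ∧ (r : ℝ) < v) ∧ p ≤ empiricalCDF e r} := by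
    ext e
    simp only [Set.mem_preimage, Set.mem_Iio, Set.mem_iUnion, Set.mem_ofPred_eq, cdfInv]
    rw [csInf_lt_iff (bddBelow_setOf_nonneg_and _) (exists_le_empiricalCDF hT e hp)]
    constructor
    · rintro ⟨u, ⟨hu0, hup⟩, huv⟩
      obtain ⟨r, hur, hrv⟩ := exists_rat_btwn huv
      exact ⟨r, ⟨hu0.trans hur.le, hrv⟩, hup.trans (empiricalCDF_mono e hur.le)⟩
    · rintro ⟨r, ⟨hr0, hrv⟩, hrp⟩
      exact ⟨r, ⟨hr0, hrp⟩, hrv⟩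
  rw [h]
  refine MeasurableSet.iUnion fun r => ?_
  exact (MeasurableSet.const _).inter
    (measurableSet_le measurable_const (measurable_empiricalCDF _))

/-- Chebyshev's inequality for two samples: if their mean square distance is at most
`s ^ 2 ≤ φ * c ^ 2`, then at most a fraction `φ` of the pairs is more than `c` apart. -/
lemma empiricalCDF_le_add {T : ℕ} (a b : Fin T → ℝ) {s c φ : ℝ} (hc : 0 ≤ c) (hφ : 0 ≤ φ)
    (hab : (1 / (T : ℝ)) * ∑ i, (a i - b i) ^ 2 ≤ s ^ 2) (hs : s ^ 2 ≤ φ * c ^ 2) (u : ℝ) :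
    empiricalCDF a u ≤ empiricalCDF b (u + c) + φ := by
  have hind : ∀ i, (if a i ≤ u then (1 : ℝ) else 0) ≤
      (if b i ≤ u + c then 1 else 0) + (if c < |a i - b i| then 1 else 0) := by
    intro i
    by_cases h1 : a i ≤ u
    · by_cases h2 : b i ≤ u + c
      · simp only [h1, h2, if_true]; split_ifs <;> norm_num
      · have h3 : c < |a i - b i| := by
          rw [abs_sub_comm]; exact lt_of_lt_of_le (by linarith) (le_abs_self _)
        simp [h1, h2, h3]
    · simp only [h1, if_false]; positivity
  have hfrac : (1 / (T : ℝ)) * ∑ i, (if c < |a i - b i| then (1 : ℝ) else 0) ≤ φ := by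
    -- for `c = 0` the mean square distance vanishes, so the samples coincide
    rcases hc.eq_or_lt with rfl | hc
    · have hzero : (1 / (T : ℝ)) * ∑ i, (a i - b i) ^ 2 ≤ 0 := by
        have : φ * (0 : ℝ) ^ 2 = 0 := by ring
        linarith
      rcases Nat.eq_zero_or_pos T with rfl | hT
      · simpa using hφ
      · have hT' : (0 : ℝ) < 1 / (T : ℝ) := by positivity
        have hsum : ∑ i, (a i - b i) ^ 2 = 0 :=
          le_antisymm (nonpos_of_mul_nonpos_right hzero hT')
            (Finset.sum_nonneg fun _ _ => sq_nonneg _)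
        have hi : ∀ i, a i - b i = 0 := fun i => by
          simpa using (Finset.sum_eq_zero_iff_of_nonneg fun _ _ => sq_nonneg _).1 hsum i
            (Finset.mem_univ i)
        simpa [hi] using hφ
    · have h1 : ∀ i, (if c < |a i - b i| then (1 : ℝ) else 0) ≤ (a i - b i) ^ 2 / c ^ 2 := by
        intro i
        split_ifs with h
        · rw [one_le_div (by positivity), ← sq_abs (a i - b i)]
          gcongr
        · positivity
      calc (1 / (T : ℝ)) * ∑ i, (if c < |a i - b i| then (1 : ℝ) else 0)
          ≤ (1 / (T : ℝ)) * ∑ i, (a i - b i) ^ 2 / c ^ 2 := by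
            gcongr with i; exact h1 i
        _ = ((1 / (T : ℝ)) * ∑ i, (a i - b i) ^ 2) / c ^ 2 := by
            rw [← Finset.sum_div]; ring
        _ ≤ φ := by
            rw [div_le_iff₀ (by positivity)]; exact hab.trans hs
  calc empiricalCDF a u
      ≤ (1 / (T : ℝ)) * ∑ i, ((if b i ≤ u + c then (1 : ℝ) else 0) +
          (if c < |a i - b i| then 1 else 0)) := by
        unfold empiricalCDF
        gcongr with i
        exact hind i
    _ = empiricalCDF b (u + c) +
          (1 / (T : ℝ)) * ∑ i, (if c < |a i - b i| then (1 : ℝ) else 0) := by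
        rw [Finset.sum_add_distrib, mul_add]; rfl
    _ ≤ _ := by gcongr

/-! ### Hoeffding's inequality at one point -/

section Hoeffding

variable {Ω : Type*} [MeasurableSpace Ω] {P : Measure Ω} [IsProbabilityMeasure P] {T : ℕ}

/-- Hoeffding's inequality for independent variables whose ranges have length one. -/
lemma measureReal_sum_sub_integral_ge_le {X : Fin T → Ω → ℝ} (hT : 1 ≤ T)
    (hX : ∀ i, Measurable (X i)) (hind : iIndepFun X P) {a : ℝ}
    (hmem : ∀ i ω, X i ω ∈ Set.Icc a (a + 1)) {x : ℝ} (hx : 0 ≤ x) :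
    P.real {ω | T * x ≤ ∑ i, (X i ω - P[X i])} ≤ Real.exp (-2 * T * x ^ 2) := by
  have hsub : ∀ i ∈ (Finset.univ : Finset (Fin T)),
      HasSubgaussianMGF (fun ω => X i ω - P[X i]) ((‖(a + 1) - a‖₊ / 2) ^ 2) P :=
    fun i _ => hasSubgaussianMGF_of_mem_Icc (hX i).aemeasurable (ae_of_all _ (hmem i))
  have hind' : iIndepFun (fun i ω => X i ω - P[X i]) P :=
    hind.comp (fun i y => y - ∫ ω, X i ω ∂P) fun i => measurable_id.sub_const _
  have hT' : (T : ℝ) ≠ 0 := by positivity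
  refine (HasSubgaussianMGF.measure_sum_ge_le_of_iIndepFun hind' hsub
    (by positivity : 0 ≤ T * x)).trans_eq ?_
  congr 1
  simp
  field_simp

omit [IsProbabilityMeasure P] in
lemma iIndepFun_indicator_le {e : Fin T → Ω → ℝ} (hind : iIndepFun e P) (u c : ℝ) :
    iIndepFun (fun i ω => if e i ω ≤ u then c else 0) P :=
  hind.comp (fun _ y => if y ≤ u then c else 0) fun _ =>
    Measurable.ite measurableSet_Iic measurable_const measurable_const

lemma integral_ite_le {e : Ω → ℝ} (he : Measurable e) (u c : ℝ) :
    ∫ ω, (if e ω ≤ u then c else 0) ∂P = c * cdf (P.map e) u := by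
  have := Measure.isProbabilityMeasure_map (μ := P) he.aemeasurable
  have h : (fun ω => if e ω ≤ u then c else 0) = (e ⁻¹' Set.Iic u).indicator fun _ => c := by
    rfl
  rw [h, integral_indicator_const _ (he measurableSet_Iic), cdf_eq_real,
    map_measureReal_apply he measurableSet_Iic, smul_eq_mul, mul_comm]

/-- The empirical distribution function of an i.i.d. sample exceeds the true one at a fixed point
by `x` with probability at most `exp (-2 T x²)`. -/
lemma measureReal_le_empiricalCDF_le {e : Fin T → Ω → ℝ} (hT : 1 ≤ T)
    (he : ∀ i, Measurable (e i)) (hind : iIndepFun e P) {ν : Measure ℝ}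
    (hlaw : ∀ i, P.map (e i) = ν) {x : ℝ} (hx : 0 ≤ x) (u : ℝ) :
    P.real {ω | cdf ν u + x ≤ empiricalCDF (fun i => e i ω) u} ≤ Real.exp (-2 * T * x ^ 2) := by
  have h := measureReal_sum_sub_integral_ge_le (P := P) (a := 0)
    (X := fun i ω => if e i ω ≤ u then 1 else 0) hT
    (fun i => Measurable.ite (he i measurableSet_Iic) measurable_const measurable_const)
    (iIndepFun_indicator_le hind u 1) (fun i ω => by split_ifs <;> simp) hx
  convert h using 2
  ext ω
  have hT' : (0 : ℝ) < T := by positivity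
  simp only [integral_ite_le (he _), hlaw, Finset.sum_sub_distrib, empiricalCDF]
  rw [Set.mem_ofPred_eq, Set.mem_ofPred_eq, one_div, inv_mul_eq_div, le_div_iff₀ hT']
  simp only [Finset.sum_const, Finset.card_univ, Fintype.card_fin, nsmul_eq_mul, one_mul]
  constructor <;> intro h <;> linarith

/-- The empirical distribution function falls short of the true one at a fixed point by `x` with
probability at most `exp (-2 T x²)`. -/
lemma measureReal_empiricalCDF_le_le {e : Fin T → Ω → ℝ} (hT : 1 ≤ T)
    (he : ∀ i, Measurable (e i)) (hind : iIndepFun e P) {ν : Measure ℝ}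
    (hlaw : ∀ i, P.map (e i) = ν) {x : ℝ} (hx : 0 ≤ x) (u : ℝ) :
    P.real {ω | empiricalCDF (fun i => e i ω) u ≤ cdf ν u - x} ≤ Real.exp (-2 * T * x ^ 2) := by
  have h := measureReal_sum_sub_integral_ge_le (P := P) (a := -1)
    (X := fun i ω => if e i ω ≤ u then -1 else 0) hT
    (fun i => Measurable.ite (he i measurableSet_Iic) measurable_const measurable_const)
    (iIndepFun_indicator_le hind u (-1)) (fun i ω => by split_ifs <;> simp) hx
  convert h using 2
  ext ω
  have hT' : (0 : ℝ) < T := by positivity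
  have hneg : ∑ i, (if e i ω ≤ u then (-1 : ℝ) else 0) = -∑ i, (if e i ω ≤ u then 1 else 0) := by
    rw [← Finset.sum_neg_distrib]
    exact Finset.sum_congr rfl fun i _ => by split_ifs <;> simp
  simp only [integral_ite_le (he _), hlaw, Finset.sum_sub_distrib, empiricalCDF]
  rw [Set.mem_ofPred_eq, Set.mem_ofPred_eq, one_div, inv_mul_eq_div, div_le_iff₀ hT']
  simp only [Finset.sum_const, Finset.card_univ, Fintype.card_fin, nsmul_eq_mul]
  rw [hneg]
  constructor <;> intro h <;> linarith

end Hoeffding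

/-! ### Conditional probabilities of events sandwiched by independent events -/

section CondProb

variable {Ω 𝒵 𝒲 : Type*} [mΩ : MeasurableSpace Ω] [m𝒵 : MeasurableSpace 𝒵] [MeasurableSpace 𝒲]
  {P : Measure Ω} [IsProbabilityMeasure P] {Z : Ω → 𝒵} {W : Ω → 𝒲}

lemma condProb_preimage_eq_of_indepFun (hZ : Measurable Z) (hW : Measurable W)
    (hind : IndepFun Z W P) {S : Set 𝒲} (hS : MeasurableSet S) :
    P⟦W ⁻¹' S | m𝒵.comap Z⟧ =ᵐ[P] fun _ => P.real (W ⁻¹' S) := by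
  have h := condExp_indep_eq (μ := P) (f := (W ⁻¹' S).indicator fun _ => (1 : ℝ)) hW.comap_le
    hZ.comap_le (stronglyMeasurable_const.indicator ⟨S, hS, rfl⟩) (show IndepFun W Z P from hind.symm)
  refine h.trans (Filter.Eventually.of_forall fun _ => ?_)
  simp [integral_indicator_const _ (hW hS)]

lemma condProb_mono {m : MeasurableSpace Ω} {A B : Set Ω} (hA : MeasurableSet[mΩ] A)
    (hB : MeasurableSet[mΩ] B) (hAB : ∀ᵐ ω ∂P, ω ∈ A → ω ∈ B) : P⟦A | m⟧ ≤ᵐ[P] P⟦B | m⟧ := by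
  refine condExp_mono ((integrable_const _).indicator hA) ((integrable_const _).indicator hB) ?_
  filter_upwards [hAB] with ω h
  by_cases hω : ω ∈ A
  · simp [hω, h hω]
  · simp only [Set.indicator_of_notMem hω]
    exact Set.indicator_nonneg (fun _ _ => zero_le_one) _

lemma condProb_le_of_indepFun (hZ : Measurable Z) (hW : Measurable W) (hind : IndepFun Z W P)
    {A : Set Ω} (hA : MeasurableSet A) {S : Set 𝒲} (hS : MeasurableSet S)
    (hAS : ∀ᵐ ω ∂P, ω ∈ A → W ω ∈ S) :
    ∀ᵐ ω ∂P, (P⟦A | m𝒵.comap Z⟧) ω ≤ P.real (W ⁻¹' S) := by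
  filter_upwards [condProb_mono (m := m𝒵.comap Z) hA (hW hS) hAS,
    condProb_preimage_eq_of_indepFun hZ hW hind hS] with ω h1 h2
  exact h1.trans_eq h2

lemma le_condProb_of_indepFun (hZ : Measurable Z) (hW : Measurable W) (hind : IndepFun Z W P)
    {A : Set Ω} (hA : MeasurableSet A) {S : Set 𝒲} (hS : MeasurableSet S)
    (hSA : ∀ᵐ ω ∂P, W ω ∈ S → ω ∈ A) :
    ∀ᵐ ω ∂P, P.real (W ⁻¹' S) ≤ (P⟦A | m𝒵.comap Z⟧) ω := by
  filter_upwards [condProb_mono (m := m𝒵.comap Z) (hW hS) hA hSA,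
    condProb_preimage_eq_of_indepFun hZ hW hind hS] with ω h1 h2
  exact h2.symm.trans_le h1

lemma condProb_diff {m : MeasurableSpace Ω} {A B : Set Ω} (hA : MeasurableSet[mΩ] A)
    (hB : MeasurableSet[mΩ] B) (hAB : A ⊆ B) :
    P⟦B \ A | m⟧ =ᵐ[P] fun ω => (P⟦B | m⟧) ω - (P⟦A | m⟧) ω := by
  have h : (B \ A).indicator (fun _ => (1 : ℝ)) =
      B.indicator (fun _ => 1) - A.indicator fun _ => 1 := Set.indicator_sdiff hAB _
  rw [h]
  exact condExp_sub ((integrable_const _).indicator hB) ((integrable_const _).indicator hA) m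

end CondProb

/-! ### The law of the scores -/

lemma Measurable.score {d dh : ℕ} {ψ : ℝ → Vec dh → (Vec d ≃ Vec d)}
    (hψ : Measurable fun p : Vec dh × Vec d => (ψ 1 p.1).symm p.2) {Ω : Type*}
    [MeasurableSpace Ω] {h : Ω → Vec dh} {r : Ω → Vec d} (hh : Measurable h) (hr : Measurable r) :
    Measurable fun ω => score ψ (h ω) (r ω) := by
  have hpair : Measurable fun ω => (h ω, r ω) := hh.prodMk hr
  exact (hψ.comp hpair).norm

lemma abs_score_sub_score_le {d dh : ℕ} {ψ : ℝ → Vec dh → (Vec d ≃ Vec d)} {Lψ Linv : ℝ}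
    (hbi : IsBiLipschitzFlow ψ Lψ Linv) (h : Vec dh) (r r' : Vec d) :
    |score ψ h r - score ψ h r'| ≤ Linv * ‖r - r'‖ :=
  (abs_norm_sub_norm_le _ _).trans (hbi 1 (by simp) h r r').2

instance (d : ℕ) (γ : ℝ) : IsProbabilityMeasure (sourceMeasure d γ) :=
  Measure.isProbabilityMeasure_map (by fun_prop)

/-- The law of `‖N‖` for `N ∼ N(0, γ I_d)`. -/
noncomputable def scoreLaw (d : ℕ) (γ : ℝ) : Measure ℝ := (sourceMeasure d γ).map fun x => ‖x‖

instance (d : ℕ) (γ : ℝ) : IsProbabilityMeasure (scoreLaw d γ) :=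
  Measure.isProbabilityMeasure_map (by fun_prop)

lemma scoreLaw_eq_map (d : ℕ) (γ : ℝ) :
    scoreLaw d γ = (stdGaussian (Vec d)).map fun x => √γ * ‖x‖ := by
  rw [scoreLaw, sourceMeasure, Measure.map_map (by fun_prop) (by fun_prop)]
  congr 1
  funext x
  simp [norm_smul]

instance (d : ℕ) : IsProbabilityMeasure (chiMeasure d) :=
  Measure.isProbabilityMeasure_map (by fun_prop)

lemma cdf_chiMeasure (d : ℕ) {γ : ℝ} (hγ : 0 < γ) (v : ℝ) :
    cdf (chiMeasure d) v = cdf (scoreLaw d γ) (√γ * v) := by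
  have hγ' : 0 < √γ := Real.sqrt_pos.2 hγ
  rw [cdf_eq_real, cdf_eq_real, scoreLaw_eq_map, chiMeasure,
    map_measureReal_apply (by fun_prop) measurableSet_Iic,
    map_measureReal_apply (by fun_prop) measurableSet_Iic]
  congr 1
  ext x
  simp [mul_le_mul_iff_right₀ hγ']

/-- A continuous distribution function of a nonnegative variable vanishes at `0`. In dimension
`d = 0`, where the score is `0`, the distribution function is not continuous. -/
lemma cdf_scoreLaw_zero {d : ℕ} {γ : ℝ} (hcont : Continuous (cdf (scoreLaw d γ))) :
    cdf (scoreLaw d γ) 0 = 0 := by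
  rw [← measureReal_Iio_eq_cdf _ hcont, scoreLaw,
    map_measureReal_apply (by fun_prop) measurableSet_Iio]
  have : (fun x : Vec d => ‖x‖) ⁻¹' Set.Iio 0 = ∅ := by
    ext x; simp
  rw [this, measureReal_empty]

lemma integral_norm_sq_stdGaussian (d : ℕ) : ∫ x, ‖x‖ ^ 2 ∂(stdGaussian (Vec d)) = d := by
  have h1 : ∫ y : ℝ, y ^ 2 ∂(gaussianReal 0 1) = 1 := by
    have h := variance_id_gaussianReal (μ := 0) (v := 1)
    rw [variance_eq_integral (by fun_prop)] at h
    simpa using h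
  have hmp : ∀ i : Fin d, MeasurePreserving (Function.eval i)
      (Measure.pi fun _ : Fin d => gaussianReal 0 1) (gaussianReal 0 1) :=
    fun i => measurePreserving_eval _ i
  have hint : Integrable (fun y : ℝ => y ^ 2) (gaussianReal 0 1) :=
    (IsGaussian.memLp_two_id (μ := gaussianReal 0 1)).integrable_sq
  rw [← map_pi_eq_stdGaussian, integral_map (by fun_prop) (by fun_prop)]
  simp only [EuclideanSpace.real_norm_sq_eq]
  have hint' : ∀ i : Fin d, Integrable (fun x : Fin d → ℝ => x i ^ 2)
      (Measure.pi fun _ => gaussianReal 0 1) := fun i => (hmp i).integrable_comp_of_integrable hint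
  rw [integral_finsetSum _ fun i _ => hint' i]
  have h2 : ∀ i : Fin d, ∫ x : Fin d → ℝ, x i ^ 2 ∂(Measure.pi fun _ => gaussianReal 0 1) = 1 :=
    fun i => by
      have h := integral_map (μ := Measure.pi fun _ : Fin d => gaussianReal 0 1) (f := fun y : ℝ => y ^ 2)
        (hmp i).measurable.aemeasurable (by fun_prop)
      rw [(hmp i).map_eq, h1] at h
      exact h.symm
  simp [h2]

/-- Chebyshev's inequality for the norm of a source variable. -/
lemma sq_mul_one_sub_cdf_scoreLaw_le (d : ℕ) {γ : ℝ} (hγ : 0 < γ) {t : ℝ} (ht : 0 ≤ t) :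
    t ^ 2 * (1 - cdf (scoreLaw d γ) t) ≤ γ * d := by
  have hint : Integrable (fun x => ‖x‖ ^ 2) (stdGaussian (Vec d)) :=
    (IsGaussian.memLp_two_id (μ := stdGaussian (Vec d))).integrable_norm_pow (by norm_num)
  have hM := mul_meas_ge_le_integral_of_nonneg (μ := stdGaussian (Vec d))
    (f := fun x => γ * ‖x‖ ^ 2) (ae_of_all _ fun x => by positivity) (hint.const_mul γ) (t ^ 2)
  rw [integral_const_mul, integral_norm_sq_stdGaussian] at hM
  refine le_trans ?_ hM
  gcongr
  rw [cdf_eq_real, ← probReal_compl_eq_one_sub measurableSet_Iic, scoreLaw_eq_map,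
    map_measureReal_apply (by fun_prop) measurableSet_Iic.compl]
  refine measureReal_mono fun x hx => ?_
  simp only [Set.mem_preimage, Set.mem_compl_iff, Set.mem_Iic, not_le] at hx
  have : γ * ‖x‖ ^ 2 = (√γ * ‖x‖) ^ 2 := by rw [mul_pow, Real.sq_sqrt hγ.le]
  simp only [Set.mem_ofPred_eq, this]
  gcongr

/-- The scores have second moment `γ d`, so a density bounded by `L` forces `L √(γ d)` to be
bounded below. -/
lemma one_le_four_mul_of_cdf_scoreLaw_le {d : ℕ} {γ L : ℝ} (hγ : 0 < γ) (hL : 0 < L)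
    (hF : ∀ t, 0 ≤ t → cdf (scoreLaw d γ) t ≤ L * t) : 1 ≤ 4 * (L * (√γ * √d)) := by
  -- below `1 / (2 L)` there is at most half of the mass, so the second moment is at least
  -- `1 / (8 L²)`
  have h1 := sq_mul_one_sub_cdf_scoreLaw_le d hγ (t := 1 / (2 * L)) (by positivity)
  have h2 := hF (1 / (2 * L)) (by positivity)
  have h3 : L * (1 / (2 * L)) = 1 / 2 := by field_simp
  rw [h3] at h2
  have h4 : (1 / (2 * L)) ^ 2 * (1 / 2) ≤ γ * d :=
    (mul_le_mul_of_nonneg_left (by linarith) (by positivity)).trans h1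
  have h5 : (1 : ℝ) / 8 ≤ L ^ 2 * (γ * d) := by
    have h6 : L ^ 2 * ((1 / (2 * L)) ^ 2 * (1 / 2)) = 1 / 8 := by field_simp; norm_num
    rw [← h6]
    gcongr
  have h7 : (4 * (L * (√γ * √d))) ^ 2 = 16 * (L ^ 2 * (γ * d)) := by
    rw [mul_pow, mul_pow, mul_pow, Real.sq_sqrt hγ.le, Real.sq_sqrt (by positivity)]; norm_num
  refine le_of_sq_le_sq ?_ (by positivity)
  rw [h7]; linarith

section Law

variable {Ω 𝒵 : Type*} [MeasurableSpace Ω] [MeasurableSpace 𝒵] {P : Measure Ω}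
  [IsProbabilityMeasure P] {d dh : ℕ} {γ : ℝ} {Z : Ω → 𝒵} {ε : Ω → Vec d} {Enc : 𝒵 → Vec dh}
  {ψ : ℝ → Vec dh → (Vec d ≃ Vec d)}

/-- If the flow transports the source distribution to the conditional law of the noise, then
whatever the context, the score of the noise is distributed as the norm of a source variable. -/
lemma map_prodMk_score (hZ : Measurable Z) (hε : Measurable ε) (hEnc : Measurable Enc)
    (hψmeas : Measurable fun p : Vec dh × Vec d => (ψ 1 p.1).symm p.2)
    (hψ : ∀ h, Measurable (ψ 1 h))
    (hacc : ∀ᵐ z ∂(P.map Z),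
      condDistrib ε Z P z = (sourceMeasure d γ).map (ψ 1 (Enc z))) :
    P.map (fun ω => (Z ω, score ψ (Enc (Z ω)) (ε ω))) = (P.map Z).prod (scoreLaw d γ) := by
  have hs : Measurable fun p : 𝒵 × Vec d => score ψ (Enc p.1) p.2 :=
    Measurable.score hψmeas (hEnc.comp measurable_fst) measurable_snd
  have hg : Measurable fun p : 𝒵 × Vec d => (p.1, score ψ (Enc p.1) p.2) :=
    measurable_fst.prodMk hs
  have : IsProbabilityMeasure (P.map Z) := Measure.isProbabilityMeasure_map hZ.aemeasurable
  refine (Measure.prod_eq fun A B hA hB => ?_).symm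
  have hmap : P.map (fun ω => (Z ω, score ψ (Enc (Z ω)) (ε ω))) =
      ((P.map Z) ⊗ₘ condDistrib ε Z P).map fun p => (p.1, score ψ (Enc p.1) p.2) := by
    rw [compProd_map_condDistrib hε.aemeasurable, Measure.map_map hg (hZ.prodMk hε)]
    rfl
  rw [hmap, Measure.map_apply hg (hA.prod hB), Measure.compProd_apply (hg (hA.prod hB))]
  have hset : ∀ z, Prod.mk z ⁻¹' ((fun p : 𝒵 × Vec d => (p.1, score ψ (Enc p.1) p.2)) ⁻¹' A ×ˢ B)
      = {x | z ∈ A ∧ score ψ (Enc z) x ∈ B} := fun z => rfl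
  have hfib : ∀ᵐ z ∂(P.map Z), condDistrib ε Z P z {x | z ∈ A ∧ score ψ (Enc z) x ∈ B} =
      A.indicator (fun _ => scoreLaw d γ B) z := by
    filter_upwards [hacc] with z hz
    by_cases hzA : z ∈ A
    · have hB' : MeasurableSet {x | score ψ (Enc z) x ∈ B} :=
        (hs.comp measurable_prodMk_left) hB
      have hpre : ψ 1 (Enc z) ⁻¹' {x | score ψ (Enc z) x ∈ B} = (fun x => ‖x‖) ⁻¹' B := by
        ext x; simp [score]
      simp only [hzA, true_and, Set.indicator_of_mem]
      rw [hz, Measure.map_apply (hψ _) hB', hpre, scoreLaw, Measure.map_apply (by fun_prop) hB]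
    · simp [hzA]
  simp only [hset]
  rw [lintegral_congr_ae hfib, lintegral_indicator_const hA, mul_comm]

lemma map_eq_of_map_prodMk_eq_prod {Z : Ω → 𝒵} {e : Ω → ℝ} (hZ : Measurable Z)
    {ρ : Measure ℝ} [IsProbabilityMeasure ρ]
    (h : P.map (fun ω => (Z ω, e ω)) = (P.map Z).prod ρ) : P.map e = ρ := by
  have : IsProbabilityMeasure (P.map Z) := Measure.isProbabilityMeasure_map hZ.aemeasurable
  rw [← Measure.snd_prod (μ := P.map Z) (ν := ρ), ← h, Measure.snd_map_prodMk hZ]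

lemma indepFun_of_map_prodMk_eq_prod {Z : Ω → 𝒵} {e : Ω → ℝ} (hZ : Measurable Z)
    (he : Measurable e) {ρ : Measure ℝ} [IsProbabilityMeasure ρ]
    (h : P.map (fun ω => (Z ω, e ω)) = (P.map Z).prod ρ) : IndepFun Z e P := by
  rw [indepFun_iff_map_prod_eq_prod_map_map hZ.aemeasurable he.aemeasurable,
    map_eq_of_map_prodMk_eq_prod hZ h, h]

end Law

/-! ### Conditional coverage -/

section Coverage

variable {Ω 𝒵 : Type*} [MeasurableSpace Ω] [m𝒵 : MeasurableSpace 𝒵] {P : Measure Ω}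
  [IsProbabilityMeasure P] {Z : Ω → 𝒵} {L s : ℝ}

/-- Thresholding a score that is within `s` of a score `e` independent of `Z`. -/
lemma abs_condProb_le_threshold_sub_le {e ehat : Ω → ℝ} (hZ : Measurable Z) (he : Measurable e)
    (hehat : Measurable ehat) (hind : IndepFun Z e P)
    (hlip : ∀ a b, |cdf (P.map e) a - cdf (P.map e) b| ≤ L * |a - b|) (hs : 0 ≤ s)
    (hclose : ∀ᵐ ω ∂P, |ehat ω - e ω| ≤ s) (r : ℝ) :
    ∀ᵐ ω ∂P, |(P⟦{ω' | ehat ω' ≤ r} | m𝒵.comap Z⟧) ω - cdf (P.map e) r| ≤ L * s := by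
  have := Measure.isProbabilityMeasure_map (μ := P) he.aemeasurable
  have hA : MeasurableSet {ω' | ehat ω' ≤ r} := hehat measurableSet_Iic
  have hF : ∀ a, P.real (e ⁻¹' Set.Iic a) = cdf (P.map e) a := fun a => by
    rw [cdf_eq_real, map_measureReal_apply he measurableSet_Iic]
  have hup := condProb_le_of_indepFun hZ he hind hA (S := Set.Iic (r + s)) measurableSet_Iic (by
    filter_upwards [hclose] with ω h1 h2
    have := (abs_le.1 h1).1
    have h3 : ehat ω ≤ r := h2
    exact Set.mem_Iic.2 (by linarith))
  have hlow := le_condProb_of_indepFun hZ he hind hA (S := Set.Iic (r - s)) measurableSet_Iic (by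
    filter_upwards [hclose] with ω h1 h2
    have := (abs_le.1 h1).2
    have h3 : e ω ≤ r - s := h2
    show ehat ω ≤ r
    linarith)
  have h1 := hlip (r + s) r
  have h2 := hlip (r - s) r
  rw [show r + s - r = s by ring, abs_of_nonneg hs] at h1
  rw [show r - s - r = -s by ring, abs_neg, abs_of_nonneg hs] at h2
  filter_upwards [hup, hlow] with ω h3 h4
  rw [hF] at h3 h4
  rw [abs_le] at h1 h2 ⊢
  constructor <;> linarith [h1.2, h2.1]

/-- One empirical quantile. Here `ehat` approximates i.i.d. scores `e`, jointly independent of `Z`: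
the last one within `s`, the past ones within `s` in mean square. The event `D` compares the last
approximate score with the quantile of level `p` of the past ones; it may or may not contain the
case of equality. The error comes from the `L`-Lipschitz distribution function over a distance `c`,
the fluctuation `x` of the empirical distribution function, the fraction `φ` of past scores that
are more than `c` off, and the exceptional event of Hoeffding's inequality. -/
lemma abs_condProb_lt_quantile_sub_le {T : ℕ} (hT : 1 ≤ T) {e ehat : Fin (T + 1) → Ω → ℝ}
    (hZ : Measurable Z) (he : ∀ i, Measurable (e i))
    (hiid : iIndepFun e P) (hident : ∀ i j, IdentDistrib (e i) (e j) P P)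
    (hind : IndepFun Z (fun ω i => e i ω) P)
    (hlip : ∀ a b, |cdf (P.map (e (Fin.last T))) a - cdf (P.map (e (Fin.last T))) b|
      ≤ L * |a - b|)
    (h0 : cdf (P.map (e (Fin.last T))) 0 = 0) (hs : 0 ≤ s)
    (hlast : ∀ᵐ ω ∂P, |ehat (Fin.last T) ω - e (Fin.last T) ω| ≤ s)
    (hpast : ∀ᵐ ω ∂P, (1 / (T : ℝ)) *
      ∑ i : Fin T, (ehat i.castSucc ω - e i.castSucc ω) ^ 2 ≤ s ^ 2)
    {c φ x : ℝ} (hc : 0 ≤ c) (hφ : 0 ≤ φ) (hx : 0 < x) (hscφ : s ^ 2 ≤ φ * c ^ 2)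
    {p : ℝ} (hp : p ∈ Set.Icc (0 : ℝ) 1) {D : Set Ω} (hD : MeasurableSet D)
    (hDlt : ∀ ω, ehat (Fin.last T) ω < cdfInv (empiricalCDF fun i : Fin T => ehat i.castSucc ω) p →
      ω ∈ D)
    (hDle : ∀ ω ∈ D,
      ehat (Fin.last T) ω ≤ cdfInv (empiricalCDF fun i : Fin T => ehat i.castSucc ω) p) :
    ∀ᵐ ω ∂P, |(P⟦D | m𝒵.comap Z⟧) ω - p| ≤
      L * c + x + φ + L * s + Real.exp (-2 * T * x ^ 2) := by
  set ν := P.map (e (Fin.last T)) with hν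
  have : IsProbabilityMeasure ν := Measure.isProbabilityMeasure_map (he _).aemeasurable
  have hcont : Continuous (cdf ν) := continuous_of_abs_sub_le_mul hlip
  have hW : Measurable fun ω i => e i ω := measurable_pi_lambda _ he
  have hlaw : ∀ i : Fin T, P.map (e i.castSucc) = ν := fun i => (hident _ _).map_eq
  have hiid' : iIndepFun (fun i : Fin T => e i.castSucc) P :=
    hiid.precomp (Fin.castSucc_injective T)
  have hlip' : ∀ a b, a ≤ b → cdf ν b ≤ cdf ν a + L * (b - a) := fun a b hab => by
    have h := (abs_le.1 (hlip b a)).2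
    rw [abs_of_nonneg (sub_nonneg.2 hab)] at h
    linarith
  have hemp : ∀ u, Measurable fun w : Fin (T + 1) → ℝ =>
      empiricalCDF (fun i : Fin T => w i.castSucc) u := fun u =>
    (measurable_empiricalCDF u).comp (measurable_pi_lambda _ fun i => measurable_pi_apply _)
  have hexp := Real.exp_nonneg (-2 * T * x ^ 2)
  -- `η` is the error in the level of the quantile; the level of the last score is off by `L * s`
  set η := L * c + x + φ with hη
  have hLmul : ∀ a, 0 ≤ a → 0 ≤ L * a := fun a ha => by
    have h := (abs_nonneg _).trans (hlip a 0)
    rwa [sub_zero, abs_of_nonneg ha] at h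
  have hLs : 0 ≤ L * s := hLmul s hs
  have hη0 : 0 < η := by linarith [hLmul c hc]
  have hupper : ∀ᵐ ω ∂P, (P⟦D | m𝒵.comap Z⟧) ω ≤
      p + η + L * s + Real.exp (-2 * T * x ^ 2) := by
    by_cases hpη : p + η < 1
    swap
    · -- the bound is at least `1`
      filter_upwards [condProb_le_of_indepFun hZ hW hind hD (S := Set.univ) MeasurableSet.univ
        (ae_of_all _ fun _ _ => Set.mem_univ _)] with ω h
      have h1 : P.real ((fun ω i => e i ω) ⁻¹' Set.univ) ≤ 1 := measureReal_le_one
      linarith [not_lt.1 hpη]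
    obtain ⟨v, hv0, hv⟩ := exists_cdf_eq ν hcont h0 (p := p + η) (by linarith [hp.1]) hpη
    -- off the exceptional set `S₂`, the empirical quantile is at most `v`
    let S₁ : Set (Fin (T + 1) → ℝ) := {w | w (Fin.last T) ≤ v + s}
    let S₂ : Set (Fin (T + 1) → ℝ) :=
      {w | empiricalCDF (fun i : Fin T => w i.castSucc) (v - c) ≤ cdf ν (v - c) - x}
    have hS₁ : MeasurableSet S₁ := measurableSet_le (measurable_pi_apply _) measurable_const
    have hS₂ : MeasurableSet S₂ := measurableSet_le (hemp _) measurable_const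
    have hDS : ∀ᵐ ω ∂P, ω ∈ D → (fun i => e i ω) ∈ S₁ ∪ S₂ := by
      filter_upwards [hlast, hpast] with ω h1 h2 hωD
      by_contra hcon
      rw [Set.mem_union, not_or] at hcon
      have h3 : v + s < e (Fin.last T) ω := not_le.1 hcon.1
      have h4 : cdf ν (v - c) - x < empiricalCDF (fun i : Fin T => e i.castSucc ω) (v - c) :=
        not_le.1 hcon.2
      have h5 := empiricalCDF_le_add (fun i : Fin T => e i.castSucc ω)
        (fun i : Fin T => ehat i.castSucc ω) hc hφ
        (by simpa only [sub_sq_comm (e _ ω) (ehat _ ω)] using h2) hscφ (v - c)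
      rw [sub_add_cancel] at h5
      have h6 := hlip' (v - c) v (by linarith)
      rw [sub_sub_cancel] at h6
      have h7 : cdfInv (empiricalCDF fun i : Fin T => ehat i.castSucc ω) p ≤ v :=
        cdfInv_le hv0 (by linarith)
      have h8 := hDle ω hωD
      have h9 := (abs_le.1 h1).1
      linarith
    filter_upwards [condProb_le_of_indepFun hZ hW hind hD (hS₁.union hS₂) hDS] with ω h
    have h1 : P.real ((fun ω i => e i ω) ⁻¹' S₁) = cdf ν (v + s) := by
      rw [cdf_eq_real, hν, map_measureReal_apply (he _) measurableSet_Iic]; rfl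
    have h2 : P.real ((fun ω i => e i ω) ⁻¹' S₂) ≤ Real.exp (-2 * T * x ^ 2) :=
      measureReal_empiricalCDF_le_le hT (fun i => he i.castSucc) hiid' hlaw hx.le (v - c)
    have h3 : P.real ((fun ω i => e i ω) ⁻¹' (S₁ ∪ S₂)) ≤ _ := measureReal_union_le
      ((fun ω i => e i ω) ⁻¹' S₁) ((fun ω i => e i ω) ⁻¹' S₂)
    have h4 := hlip' v (v + s) (by linarith)
    rw [add_sub_cancel_left] at h4
    linarith
  have hlower : ∀ᵐ ω ∂P, p - η - L * s - Real.exp (-2 * T * x ^ 2) ≤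
      (P⟦D | m𝒵.comap Z⟧) ω := by
    by_cases hpη : 0 ≤ p - η
    swap
    · -- the bound is negative
      filter_upwards [le_condProb_of_indepFun hZ hW hind hD (S := ∅) MeasurableSet.empty
        (ae_of_all _ fun _ h => h.elim)] with ω h
      have h1 : 0 ≤ P.real ((fun ω i => e i ω) ⁻¹' ∅) := measureReal_nonneg
      linarith [not_le.1 hpη]
    obtain ⟨v, hv0, hv⟩ := exists_cdf_eq ν hcont h0 hpη (by linarith [hp.2])
    -- off the exceptional set `S₂`, the empirical quantile is at least `v`
    let S₁ : Set (Fin (T + 1) → ℝ) := {w | w (Fin.last T) < v - s}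
    let S₂ : Set (Fin (T + 1) → ℝ) :=
      {w | cdf ν (v + c) + x ≤ empiricalCDF (fun i : Fin T => w i.castSucc) (v + c)}
    have hS₁ : MeasurableSet S₁ := measurableSet_lt (measurable_pi_apply _) measurable_const
    have hS₂ : MeasurableSet S₂ := measurableSet_le measurable_const (hemp _)
    have hDS : ∀ᵐ ω ∂P, (fun i => e i ω) ∈ S₁ \ S₂ → ω ∈ D := by
      filter_upwards [hlast, hpast] with ω h1 h2 hωS
      have h3 : e (Fin.last T) ω < v - s := hωS.1
      have h4 : empiricalCDF (fun i : Fin T => e i.castSucc ω) (v + c) < cdf ν (v + c) + x :=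
        not_le.1 hωS.2
      have h5 := empiricalCDF_le_add (fun i : Fin T => ehat i.castSucc ω)
        (fun i : Fin T => e i.castSucc ω) hc hφ h2 hscφ v
      have h6 := hlip' v (v + c) (by linarith)
      rw [add_sub_cancel_left] at h6
      have h7 : v ≤ cdfInv (empiricalCDF fun i : Fin T => ehat i.castSucc ω) p :=
        le_cdfInv (empiricalCDF_mono _) (exists_le_empiricalCDF hT _ hp.2) (by linarith)
      have h9 := (abs_le.1 h1).2
      exact hDlt ω (by linarith)
    filter_upwards [le_condProb_of_indepFun hZ hW hind hD (hS₁.diff hS₂) hDS] with ω h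
    have h1 : P.real ((fun ω i => e i ω) ⁻¹' S₁) = cdf ν (v - s) := by
      rw [← measureReal_Iio_eq_cdf ν hcont, hν, map_measureReal_apply (he _) measurableSet_Iio]
      rfl
    have h2 : P.real ((fun ω i => e i ω) ⁻¹' S₂) ≤ Real.exp (-2 * T * x ^ 2) :=
      measureReal_le_empiricalCDF_le hT (fun i => he i.castSucc) hiid' hlaw hx.le (v + c)
    have h3 : P.real ((fun ω i => e i ω) ⁻¹' S₁) - P.real ((fun ω i => e i ω) ⁻¹' S₂) ≤
        P.real ((fun ω i => e i ω) ⁻¹' (S₁ \ S₂)) := le_measureReal_sdiff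
    have h4 := hlip' (v - s) v (by linarith)
    rw [sub_sub_cancel] at h4
    linarith
  filter_upwards [hupper, hlower] with ω h1 h2
  rw [abs_le]
  constructor <;> linarith

lemma le_measureReal_of_ae {δ : ℝ} (hδ : 0 ≤ δ) {A : Set Ω} (hA : ∀ᵐ ω ∂P, ω ∈ A) :
    1 - δ ≤ P.real A := by
  have h : P A = 1 := by
    rw [measure_congr (Filter.eventuallyEq_univ.2 hA : A =ᵐ[P] Set.univ), measure_univ]
  rw [measureReal_def, h, ENNReal.toReal_one]
  linarith

end Coverage

/-! ### The constants of the bound -/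

lemma exp_neg_two_mul_sq_sqrt_log_le {T : ℕ} (hT : 1 ≤ T) :
    Real.exp (-2 * T * √(Real.log (16 * (T : ℝ)) / (T : ℝ)) ^ 2) ≤
      √(Real.log (16 * (T : ℝ)) / (T : ℝ)) := by
  have hT' : (1 : ℝ) ≤ T := by exact_mod_cast hT
  have hlog : 1 ≤ Real.log (16 * (T : ℝ)) := by
    rw [Real.le_log_iff_exp_le (by positivity)]
    linarith [Real.exp_one_lt_d9]
  rw [Real.sq_sqrt (by positivity)]
  have h1 : -2 * (T : ℝ) * (Real.log (16 * T) / T) = -Real.log (16 * T) + -Real.log (16 * T) := by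
    field_simp; ring
  rw [h1, Real.exp_add, Real.exp_neg, Real.exp_log (by positivity)]
  refine Real.le_sqrt_of_sq_le ?_
  rw [div_eq_mul_inv]
  have h2 : (16 * (T : ℝ))⁻¹ ≤ 1 := inv_le_one_of_one_le₀ (by linarith)
  have h2' : 0 ≤ (16 * (T : ℝ))⁻¹ := by positivity
  have h3 : (16 * (T : ℝ))⁻¹ ≤ (T : ℝ)⁻¹ := inv_anti₀ (by linarith) (by linarith)
  calc ((16 * (T : ℝ))⁻¹ * (16 * (T : ℝ))⁻¹) ^ 2
      ≤ (16 * (T : ℝ))⁻¹ := by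
        have h4 : (16 * (T : ℝ))⁻¹ * (16 * (T : ℝ))⁻¹ ≤ (16 * (T : ℝ))⁻¹ := by nlinarith
        nlinarith [mul_nonneg h2' h2']
    _ ≤ (T : ℝ)⁻¹ := h3
    _ ≤ Real.log (16 * T) * (T : ℝ)⁻¹ := le_mul_of_one_le_left (by positivity) hlog

lemma sq_scoreErrorConst {d T : ℕ} {γ δ Linv δT : ℝ} (hLinv : 0 ≤ Linv) (hδT : 0 ≤ δT) :
    scoreErrorConst d T γ δ Linv δT ^ 2 =
      normBound d T γ δ * (Linv * δT) + (Linv * δT) ^ 2 := by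
  have : 0 ≤ normBound d T γ δ := by unfold normBound; positivity
  rw [scoreErrorConst, Real.sq_sqrt (by positivity)]
  ring

lemma mul_le_scoreErrorConst {d T : ℕ} {γ δ Linv δT : ℝ} (hLinv : 0 ≤ Linv) (hδT : 0 ≤ δT) :
    Linv * δT ≤ scoreErrorConst d T γ δ Linv δT := by
  have : 0 ≤ normBound d T γ δ := by unfold normBound; positivity
  refine le_of_sq_le_sq ?_ (Real.sqrt_nonneg _)
  rw [sq_scoreErrorConst hLinv hδT]
  have : 0 ≤ normBound d T γ δ * (Linv * δT) := by positivity
  linarith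

/-- With `s = Linv * δT`, at most a fraction `L * s` of the past scores can be off by more than
twice the constant `C`: as `C² = M s + s²`, this amounts to `1 ≤ 4 L M`. -/
lemma sq_le_mul_sq_scoreErrorConst {d T : ℕ} {γ δ Linv δT L : ℝ} (hL : 0 ≤ L)
    (hLinv : 0 ≤ Linv) (hδT : 0 ≤ δT) (h : 1 ≤ 4 * (L * (√γ * √d))) :
    (Linv * δT) ^ 2 ≤ L * (Linv * δT) * (2 * scoreErrorConst d T γ δ Linv δT) ^ 2 := by
  have hM : √γ * √d ≤ normBound d T γ δ := by
    unfold normBound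
    gcongr
    exact le_add_of_nonneg_right (Real.sqrt_nonneg _)
  have h1 : 1 ≤ 4 * (L * normBound d T γ δ) := h.trans (by gcongr)
  rw [mul_pow 2, sq_scoreErrorConst hLinv hδT]
  set s := Linv * δT
  have hs : 0 ≤ s := by positivity
  calc s ^ 2 ≤ s ^ 2 * (4 * (L * normBound d T γ δ)) := le_mul_of_one_le_right (by positivity) h1
    _ ≤ s ^ 2 * (4 * (L * normBound d T γ δ)) + 4 * L * s ^ 3 :=
      le_add_of_nonneg_right (by positivity)
    _ = _ := by ring

/-! ### The coverage bounds -/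

/-- The times `1, …, T+1` are the elements of `Fin (T + 1)`, the test time is `Fin.last T`.
`X i` is the regressor window, `Y i = f (X i) + ε i` the response, `Yhat i` its point prediction,
`Z i` the context and `Enc (Z i)` the guidance at time `i`.
The conditional coverage given `Z_{T+1}` is the conditional probability of the event
`Y_{T+1} ∈ Ĉ_{T+1}` given the σ-algebra of `Z_{T+1}`, and "with probability `1 - δ`" refers to the
value of `Z_{T+1}`. -/
theorem theorem1
    {Ω 𝒳 𝒵 : Type*} [MeasurableSpace Ω] [MeasurableSpace 𝒳] [MeasurableSpace 𝒵]
    (P : Measure Ω) [IsProbabilityMeasure P]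
    (T d dh : ℕ) (hT : 1 ≤ T)
    (α δ γ : ℝ) (hα : α ∈ Set.Ioo (0 : ℝ) 1) (hδ : δ ∈ Set.Ioo (0 : ℝ) 1) (hγ : 0 < γ)
    -- the data
    (X : Fin (T + 1) → Ω → 𝒳) (Y Yhat : Fin (T + 1) → Ω → Vec d) (Z : Fin (T + 1) → Ω → 𝒵)
    (hX : ∀ i, Measurable (X i)) (hY : ∀ i, Measurable (Y i))
    (hYhat : ∀ i, Measurable (Yhat i)) (hZ : ∀ i, Measurable (Z i))
    (f : 𝒳 → Vec d) (hf : Measurable f)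
    (ε : Fin (T + 1) → Ω → Vec d) (hε : ∀ i ω, Y i ω = f (X i ω) + ε i ω)
    (Enc : 𝒵 → Vec dh) (hEnc : Measurable Enc)
    -- the guided flow and its bi-Lipschitz continuity
    (u : ℝ → Vec d → Vec dh → Vec d) (ψ : ℝ → Vec dh → (Vec d ≃ Vec d))
    (hψ : IsGuidedFlow u ψ)
    (hψmeas : Measurable (fun p : Vec dh × Vec d => (ψ 1 p.1).symm p.2))
    (Lψ Linv : ℝ) (hLψ : 0 < Lψ) (hLinv : 0 < Linv) (hbi : IsBiLipschitzFlow ψ Lψ Linv)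
    -- the flow transports the source distribution to the conditional law of the noise
    (hacc : ∀ i, ∀ᵐ z ∂(P.map (Z i)),
      condDistrib (ε i) (Z i) P z = (sourceMeasure d γ).map (ψ 1 (Enc z)))
    -- the true scores, which are i.i.d., and the estimated scores
    (e ehat : Fin (T + 1) → Ω → ℝ)
    (he : ∀ i ω, e i ω = score ψ (Enc (Z i ω)) (ε i ω))
    (hehat : ∀ i ω, ehat i ω = score ψ (Enc (Z i ω)) (Y i ω - Yhat i ω))
    (hindep : iIndepFun e P) (hident : ∀ i j, IdentDistrib (e i) (e j) P P)
    -- the distribution function of the true scores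
    (L : ℝ) (hL : 0 < L)
    (hFlip : ∀ a b : ℝ,
      |cdf (P.map (e (Fin.last T))) a - cdf (P.map (e (Fin.last T))) b| ≤ L * |a - b|)
    (hFmono : StrictMonoOn (cdf (P.map (e (Fin.last T)))) (Set.Ici 0))
    -- the estimation quality
    (δT : ℝ)
    (htrain : ∀ᵐ ω ∂P, (1 / (T : ℝ)) *
      ∑ i : Fin T, ‖(Y i.castSucc ω - Yhat i.castSucc ω) - ε i.castSucc ω‖ ^ 2 ≤ δT ^ 2)
    (htest : ∀ᵐ ω ∂P,
      ‖(Y (Fin.last T) ω - Yhat (Fin.last T) ω) - ε (Fin.last T) ω‖ ≤ δT) :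
    -- the prediction set given by the ball of mass `1 - α` of the source distribution
    1 - δ ≤ P.real {ω |
      |(P⟦{ω' | Y (Fin.last T) ω' ∈ predictionSet ψ γ α
            (Yhat (Fin.last T) ω') (Enc (Z (Fin.last T) ω'))}
          | MeasurableSpace.comap (Z (Fin.last T)) inferInstance⟧) ω - (1 - α)|
        ≤ coverageBound d T γ δ Linv δT L} ∧
    -- the prediction sets given by empirical quantiles of the past estimated scores
    (IndepFun (Z (Fin.last T)) (fun ω i => e i ω) P →
      ∀ β ∈ Set.Icc (0 : ℝ) α,
        1 - δ ≤ P.real {ω |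
          |(P⟦{ω' | Y (Fin.last T) ω' ∈ quantilePredictionSet ψ α β
                (fun i : Fin T => ehat i.castSucc ω')
                (Yhat (Fin.last T) ω') (Enc (Z (Fin.last T) ω'))}
              | MeasurableSpace.comap (Z (Fin.last T)) inferInstance⟧) ω - (1 - α)|
            ≤ coverageBound d T γ δ Linv δT L}) := by
  have hεm : ∀ i, Measurable (ε i) := fun i => by
    have h : ε i = fun ω => Y i ω - f (X i ω) := funext fun ω => by simp [hε i ω]
    rw [h]
    exact (hY i).sub (hf.comp (hX i))
  have hem : ∀ i, Measurable (e i) := fun i => by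
    rw [show e i = fun ω => score ψ (Enc (Z i ω)) (ε i ω) from funext (he i)]
    exact Measurable.score hψmeas (hEnc.comp (hZ i)) (hεm i)
  have hehatm : ∀ i, Measurable (ehat i) := fun i => by
    rw [show ehat i = fun ω => score ψ (Enc (Z i ω)) (Y i ω - Yhat i ω) from funext (hehat i)]
    exact Measurable.score hψmeas (hEnc.comp (hZ i)) ((hY i).sub (hYhat i))
  have hψcont : ∀ h, Measurable (ψ 1 h) := fun h =>
    (LipschitzWith.of_dist_le' (K := Lψ) fun x y => by
      simpa only [dist_eq_norm] using (hbi 1 (by simp) h x y).1).continuous.measurable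
  -- the score at the test time is independent of the context and has the law of `‖N‖`
  have hprod : P.map (fun ω => (Z (Fin.last T) ω, e (Fin.last T) ω)) =
      (P.map (Z (Fin.last T))).prod (scoreLaw d γ) := by
    simp only [he]
    exact map_prodMk_score (hZ _) (hεm _) hEnc hψmeas hψcont (hacc _)
  have hlaw : P.map (e (Fin.last T)) = scoreLaw d γ := map_eq_of_map_prodMk_eq_prod (hZ _) hprod
  have hindlast : IndepFun (Z (Fin.last T)) (e (Fin.last T)) P :=
    indepFun_of_map_prodMk_eq_prod (hZ _) (hem _) hprod
  have hcont : Continuous (cdf (P.map (e (Fin.last T)))) := continuous_of_abs_sub_le_mul hFlip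
  have h0 : cdf (P.map (e (Fin.last T))) 0 = 0 := by
    rw [hlaw] at hcont ⊢
    exact cdf_scoreLaw_zero hcont
  have hδT : 0 ≤ δT := by
    obtain ⟨ω, hω⟩ := htest.exists
    exact (norm_nonneg _).trans hω
  have hclose : ∀ i ω, |ehat i ω - e i ω| ≤ Linv * ‖(Y i ω - Yhat i ω) - ε i ω‖ := fun i ω => by
    rw [hehat, he]
    exact abs_score_sub_score_le hbi _ _ _
  have hs : 0 ≤ Linv * δT := by positivity
  have hlast : ∀ᵐ ω ∂P, |ehat (Fin.last T) ω - e (Fin.last T) ω| ≤ Linv * δT := by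
    filter_upwards [htest] with ω hω
    exact (hclose _ ω).trans (by gcongr)
  set C := scoreErrorConst d T γ δ Linv δT with hC
  have hC0 : 0 ≤ C := Real.sqrt_nonneg _
  have hsC : L * (Linv * δT) ≤ L * C :=
    mul_le_mul_of_nonneg_left (mul_le_scoreErrorConst hLinv.le hδT) hL.le
  set x := √(Real.log (16 * (T : ℝ)) / (T : ℝ)) with hxdef
  have hT' : (1 : ℝ) ≤ T := by exact_mod_cast hT
  have hx : 0 < x := by
    have : 0 < Real.log (16 * (T : ℝ)) := Real.log_pos (by linarith)
    exact Real.sqrt_pos.2 (by positivity)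
  have hB : 12 * x + 8 * (L * C) ≤ coverageBound d T γ δ Linv δT L := by
    have h1 : coverageBound d T γ δ Linv δT L =
      12 * x + 4 * (L + 1 / 2) * (2 * C + δT) := rfl
    have h2 : 0 ≤ L * δT := by positivity
    rw [h1]
    linarith
  have hLC : 0 ≤ L * C := by positivity
  constructor
  · have hr : cdf (P.map (e (Fin.last T))) (radius d γ (1 - α)) = 1 - α := by
      obtain ⟨v, hv0, hv⟩ := exists_cdf_eq _ hcont h0 (p := 1 - α) (by linarith [hα.2])
        (by linarith [hα.1])
      refine apply_mul_cdfInv_eq hcont (monotone_cdf _) (Real.sqrt_pos.2 hγ) (fun w => ?_) hv0 hv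
      rw [hlaw, cdf_chiMeasure d hγ]
    have hset : {ω' | Y (Fin.last T) ω' ∈ predictionSet ψ γ α (Yhat (Fin.last T) ω')
        (Enc (Z (Fin.last T) ω'))} = {ω' | ehat (Fin.last T) ω' ≤ radius d γ (1 - α)} := by
      ext ω'
      simp [predictionSet, hehat]
    refine le_measureReal_of_ae hδ.1.le ?_
    rw [hset]
    filter_upwards [abs_condProb_le_threshold_sub_le (hZ _) (hem _) (hehatm _) hindlast hFlip hs
      hlast (radius d γ (1 - α))] with ω hω
    rw [hr] at hω
    exact hω.trans (by linarith)
  · intro hind β hβ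
    have hpast : ∀ᵐ ω ∂P, (1 / (T : ℝ)) *
        ∑ i : Fin T, (ehat i.castSucc ω - e i.castSucc ω) ^ 2 ≤ (Linv * δT) ^ 2 := by
      filter_upwards [htrain] with ω hω
      calc (1 / (T : ℝ)) * ∑ i : Fin T, (ehat i.castSucc ω - e i.castSucc ω) ^ 2
          ≤ (1 / (T : ℝ)) * ∑ i : Fin T,
              Linv ^ 2 * ‖(Y i.castSucc ω - Yhat i.castSucc ω) - ε i.castSucc ω‖ ^ 2 := by
            gcongr with i
            rw [← mul_pow, ← sq_abs]
            gcongr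
            exact hclose _ ω
        _ = Linv ^ 2 * ((1 / (T : ℝ)) * ∑ i : Fin T,
              ‖(Y i.castSucc ω - Yhat i.castSucc ω) - ε i.castSucc ω‖ ^ 2) := by
            rw [← Finset.mul_sum]; ring
        _ ≤ (Linv * δT) ^ 2 := by
            rw [mul_pow]; gcongr
    -- the error of one quantile is taken with `c = 2 C`, `φ = L * s` for `s = Linv * δT ≤ C`, and
    -- `x = √(log (16 T) / T)`: it is at most `2 L C + x + L C + L C + x`
    have hdens : 1 ≤ 4 * (L * (√γ * √d)) := by
      refine one_le_four_mul_of_cdf_scoreLaw_le hγ hL fun t ht => ?_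
      have h := (abs_le.1 (hFlip t 0)).2
      rwa [h0, sub_zero, sub_zero, abs_of_nonneg ht, hlaw] at h
    have hscφ := sq_le_mul_sq_scoreErrorConst (T := T) (δ := δ) hL.le hLinv.le hδT hdens
    have hτ : Real.exp (-2 * T * x ^ 2) ≤ x := exp_neg_two_mul_sq_sqrt_log_le hT
    have hq : ∀ p, p ≤ 1 →
        Measurable fun ω => cdfInv (empiricalCDF fun i : Fin T => ehat i.castSucc ω) p :=
      fun p hp => (measurable_cdfInv_empiricalCDF hT hp).comp
        (measurable_pi_lambda _ fun i => hehatm i.castSucc)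
    have hplow : β ∈ Set.Icc (0 : ℝ) 1 := ⟨hβ.1, hβ.2.trans hα.2.le⟩
    have hphigh : 1 - α + β ∈ Set.Icc (0 : ℝ) 1 :=
      ⟨by linarith [hβ.1, hα.2], by linarith [hβ.2]⟩
    -- the coverage event is the difference of two events of the form treated above, the second of
    -- which contains the first since the lower quantile is at most the upper one
    let A : Set Ω := {ω | ehat (Fin.last T) ω <
      cdfInv (empiricalCDF fun i : Fin T => ehat i.castSucc ω) β}
    let B : Set Ω := {ω | ehat (Fin.last T) ω ≤
      cdfInv (empiricalCDF fun i : Fin T => ehat i.castSucc ω) (1 - α + β)}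
    have hA : MeasurableSet A := measurableSet_lt (hehatm _) (hq _ hplow.2)
    have hBm : MeasurableSet B := measurableSet_le (hehatm _) (hq _ hphigh.2)
    have hAB : A ⊆ B := fun ω hω => (le_of_lt hω).trans
      (cdfInv_le_cdfInv (exists_le_empiricalCDF hT _ hphigh.2) (by linarith [hα.2]))
    have hset : {ω' | Y (Fin.last T) ω' ∈ quantilePredictionSet ψ α β
        (fun i : Fin T => ehat i.castSucc ω') (Yhat (Fin.last T) ω')
        (Enc (Z (Fin.last T) ω'))} = B \ A := by
      ext ω'
      simp [quantilePredictionSet, A, B, hehat, and_comm]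
    refine le_measureReal_of_ae hδ.1.le ?_
    rw [hset]
    filter_upwards [condProb_diff (m := MeasurableSpace.comap (Z (Fin.last T)) inferInstance)
        hA hBm hAB,
      abs_condProb_lt_quantile_sub_le hT (hZ _) hem hindep hident hind hFlip h0 hs hlast hpast
        (by positivity) (by positivity) hx hscφ hplow hA (fun _ h => h) fun _ h => le_of_lt h,
      abs_condProb_lt_quantile_sub_le hT (hZ _) hem hindep hident hind hFlip h0 hs hlast hpast
        (by positivity) (by positivity) hx hscφ hphigh hBm (fun _ h => le_of_lt h) fun _ h => h]
      with ω h1 h2 h3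
    refine le_trans ?_ hB
    rw [h1]
    rw [abs_le] at h2 h3 ⊢
    constructor <;> linarith [h2.1, h2.2, h3.1, h3.2]
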